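/- Let $\{G_1,G_2,\dots\}\cup\{G_1^*,G_2^*,\dots\}$ be a formal alphabet. A word in these letters is called $*$-free if it contains no letter $G_r^*$, and $w^*$ is the word obtained from $w$ by reversing the order of the letters and exchanging $G_r$ and $G_r^*$ for every $r$. Two words are trace-distinct if neither is a cyclic rotation of the other. For each $N\ge 1$ let $G_1,G_2,\dots$ be i.i.d. complex Ginibre matrices of order $N$, i.e. all the entries of all these matrices are independent with law $\mathscr N_{\mathbb C}(0,1/N)$; here $\mathscr N_{\mathbb C}(0,\sigma^2)$ is the law of $X+iY$ with $X,Y$ independent real centred Gaussian variables of variance $\sigma^2/2$ each. For a word $w$ let $G_w$ be the $N\times N$ random matrix obtained by replacing each letter of $w$ by the corresponding matrix and multiplying. For a word $w$ of length $n\geq 1$, take two oriented $n$-gons whose edges are labelled, in cyclic order, by the letters of $w$ and of $w^*$ respectively. A pairing of the $2n$ edges is admissible if any two paired edges carry the labels $G_r$ and $G_r^*$ for some $r$. Gluing the paired edges coherently with the orientation (the start of each edge to the end of its partner) gives a closed oriented surface. Let $b_w$ be the number of admissible pairings for which this surface is a sphere, i.e. is connected with Euler characteristic $2$. Let $w_1,\dots,w_m$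 be non-empty $*$-free words that are pairwise trace-distinct. Then $$\bigl(\mathrm{Tr}(G_{w_1}),\dots,\mathrm{Tr}(G_{w_m})\bigr)\xrightarrow[N\to\infty]{d}(Z_1,\dots,Z_m),$$ where $Z_1,\dots,Z_m$ are independent and $Z_i$ has law $\mathscr N_{\mathbb C}(0,b_{w_i})$ for every $i$. -/

import Mathlib

open MeasureTheory ProbabilityTheory Filter
open scoped NNReal Matrix

namespace GinibreWords

/-! ### Words -/

/-- A letter `G_r` or `G_r^*` of the formal alphabet. -/
structure StarLetter where
  /-- the index `r` -/
  index : ℕ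
  /-- `true` for the star letter `G_r^*`, `false` for the letter `G_r` -/
  starred : Bool

/-- A `*`-word is a finite word in the letters `G_r`, `G_r^*`. -/
abbrev StarWord : Type := List StarLetter

/-- The letter conjugate to a given one: `G_r ↦ G_r^*` and `G_r^* ↦ G_r`. -/
def StarLetter.conj (a : StarLetter) : StarLetter := ⟨a.index, !a.starred⟩

/-- The word `w^*`: reverse the order and conjugate every letter. -/
def starWord (w : StarWord) : StarWord := w.reverse.map StarLetter.conj

/-- A word is `*`-free if it contains no letter `G_r^*`. -/
def IsStarFree (w : StarWord) : Prop := ∀ a ∈ w, a.starred = false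

/-- Two words are trace-distinct if they are not equal up to a cyclic permutation of the letters. -/
def TraceDistinct (w₁ w₂ : StarWord) : Prop := ¬ w₁ ~r w₂

/-! ### Complex Gaussian variables and Ginibre matrices -/

/-- The law `N_ℂ(0, v)` of `X + iY`, with `X`, `Y` independent real centred Gaussian variables of
variance `v / 2` each. -/
noncomputable def complexGaussian (v : ℝ≥0) : Measure ℂ :=
  ((gaussianReal 0 (v / 2)).prod (gaussianReal 0 (v / 2))).map
    (fun p : ℝ × ℝ => (p.1 : ℂ) + (p.2 : ℂ) * Complex.I)

instance (v : ℝ≥0) : IsProbabilityMeasure (complexGaussian v) :=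
  Measure.isProbabilityMeasure_map
    (by fun_prop : Measurable (fun p : ℝ × ℝ => (p.1 : ℂ) + (p.2 : ℂ) * Complex.I)).aemeasurable

/-- `G 0, G 1, …` are i.i.d. complex Ginibre matrices of order `N`: all the entries of all these
matrices are independent, and each of them has law `N_ℂ(0, 1 / N)`. -/
structure IsGinibreFamily {Ω : Type*} [MeasurableSpace Ω] (N : ℕ)
    (G : ℕ → Ω → Matrix (Fin N) (Fin N) ℂ) (μ : Measure Ω) : Prop where
  hasLaw : ∀ (r : ℕ) (s t : Fin N), HasLaw (fun ω => G r ω s t) (complexGaussian (1 / N)) μ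
  indep : iIndepFun (fun (v : ℕ × Fin N × Fin N) (ω : Ω) => G v.1 ω v.2.1 v.2.2) μ

/-- The matrix `G_w` obtained by substituting matrices `M 0, M 1, …` for the letters of `w`. -/
noncomputable def wordMatrix {N : ℕ} (M : ℕ → Matrix (Fin N) (Fin N) ℂ) (w : StarWord) :
    Matrix (Fin N) (Fin N) ℂ :=
  (w.map fun a => if a.starred then (M a.index)ᴴ else M a.index).prod

/-! ### Pairings of polygonal faces and the surfaces they produce

To words `w_1, …, w_k` correspond `k` oriented polygonal faces, the edges of the `j`-th face being
labelled, in cyclic order, by the letters of `w_j`. -/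

/-- The edges of the faces: the edge `⟨j, l⟩` carries the `l`-th letter of the `j`-th word. -/
abbrev Edge {k : ℕ} (ws : Fin k → StarWord) : Type := Σ j : Fin k, Fin (ws j).length

section Surfaces

variable {k : ℕ} {ws : Fin k → StarWord}

/-- The letter carried by an edge. -/
def Edge.letter (e : Edge ws) : StarLetter := (ws e.1).get e.2

/-- The edge which follows `e` in the cyclic order of its face. -/
def Edge.next (e : Edge ws) : Edge ws := ⟨e.1, finRotate _ e.2⟩

/-- An admissible pairing of the edges, written as the fixed-point-free involution that exchanges
paired edges: every two paired edges carry letters `G_r` and `G_r^*` for some `r`. -/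
structure IsAdmissible (φ : Equiv.Perm (Edge ws)) : Prop where
  involutive : Function.Involutive φ
  ne_self : ∀ e, φ e ≠ e
  letter_eq : ∀ e, (φ e).letter = e.letter.conj

/-- The vertices of the glued surface `S_φ`. A corner of a face is represented by the edge that
starts there, so that the edge `e` runs from the corner `e` to the corner `e.next`. Coherent gluing
of `e` with `φ e` identifies the start of `e` with the end of `φ e`, for every edge `e` (and so
also the end of `e` with the start of `φ e`). -/
def Vertex (φ : Equiv.Perm (Edge ws)) : Type :=
  Quot fun a b : Edge ws => b = (φ a).next

/-- The edges of the graph on `S_φ`: edges of the faces, paired ones being identified. -/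
def GluedEdge (φ : Equiv.Perm (Edge ws)) : Type :=
  Quot fun a b : Edge ws => b = φ a

/-- The connected components of `S_φ`: classes of faces connected through glued edges. -/
def Component (φ : Equiv.Perm (Edge ws)) : Type :=
  Quot fun i j : Fin k => ∃ e : Edge ws, e.1 = i ∧ (φ e).1 = j

/-- The Euler characteristic `V - E + F` of `S_φ`, which has `F = k` faces. -/
noncomputable def eulerChar (φ : Equiv.Perm (Edge ws)) : ℤ :=
  (Nat.card (Vertex φ) : ℤ) - (Nat.card (GluedEdge φ) : ℤ) + (k : ℤ)

/-- `S_φ`, a closed oriented surface, is a sphere: it is connected and has Euler characteristic `2`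
(that is, genus `0`). -/
def IsSpherical (φ : Equiv.Perm (Edge ws)) : Prop :=
  Nat.card (Component φ) = 1 ∧ eulerChar φ = 2

end Surfaces

/-- `b_w`: the number of spherical admissible pairings of the two faces labelled by `w`, `w^*`. -/
noncomputable def sphereCount (w : StarWord) : ℕ :=
  Nat.card {φ : Equiv.Perm (Edge ![w, starWord w]) // IsAdmissible φ ∧ IsSpherical φ}

end GinibreWords

open GinibreWords

open scoped Topology

/-- The moments of a complex Gaussian variable of variance `v`. -/
noncomputable def gaussianMoment (v : ℝ≥0) (a b : ℕ) : ℂ :=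
  if a = b then (a.factorial : ℂ) * (v : ℂ) ^ a else 0

lemma complexGaussian_zero : complexGaussian 0 = Measure.dirac 0 := by
  simp only [complexGaussian, zero_div, gaussianReal_zero_var]
  rw [Measure.dirac_prod_dirac, Measure.map_dirac' (by fun_prop)]
  simp

lemma complexGaussian_eq_withDensity {v : ℝ≥0} (hv : v ≠ 0) :
    complexGaussian v = (volume : Measure ℂ).withDensity
      (fun z => ENNReal.ofReal ((Real.pi * v)⁻¹ * Real.exp (-(v : ℝ)⁻¹ * ‖z‖ ^ 2))) := by
  have hv2 : v / 2 ≠ 0 := by simpa using hv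
  have hf : (fun p : ℝ × ℝ => (p.1 : ℂ) + (p.2 : ℂ) * Complex.I) =
      Complex.measurableEquivRealProd.symm := by
    ext p; simp [Complex.measurableEquivRealProd_symm_apply, Complex.mk_eq_add_mul_I]
  rw [complexGaussian, gaussianReal_of_var_ne_zero _ hv2,
    prod_withDensity (by fun_prop) (by fun_prop), hf]
  have hmap := Complex.volume_preserving_equiv_real_prod.symm.map_eq
  rw [← hmap]
  ext s hs
  rw [Measure.map_apply (by fun_prop) hs, withDensity_apply _ (by measurability),
    withDensity_apply _ hs, setLIntegral_map hs (by fun_prop) (by fun_prop)]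
  refine setLIntegral_congr_fun (by measurability) ?_
  intro p _
  simp only [gaussianPDF, gaussianPDFReal]
  rw [← ENNReal.ofReal_mul (by positivity)]
  congr 1
  have hv' : (v : ℝ) ≠ 0 := by simpa using hv
  rw [← hf, mul_mul_mul_comm, ← Real.exp_add, Complex.sq_norm, Complex.normSq_add_mul_I,
    ← mul_inv, ← Real.sqrt_mul_self (x := Real.pi * v) (by positivity),
    ← Real.sqrt_mul (by positivity)]
  congr 2
  · push_cast
    ring_nf
  · push_cast
    field_simp
    ring

lemma integral_complexGaussian {v : ℝ≥0} (hv : v ≠ 0) (f : ℂ → ℂ) :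
    ∫ z, f z ∂complexGaussian v =
      ∫ z : ℂ, ((Real.pi * v)⁻¹ * Real.exp (-(v : ℝ)⁻¹ * ‖z‖ ^ 2)) • f z := by
  rw [complexGaussian_eq_withDensity hv,
    integral_withDensity_eq_integral_toReal_smul (by fun_prop) (by simp)]
  congr 1
  ext z
  rw [ENNReal.toReal_ofReal (by positivity)]

lemma integral_complexGaussian_moment (v : ℝ≥0) (a b : ℕ) :
    ∫ z, z ^ a * (starRingEnd ℂ z) ^ b ∂complexGaussian v = gaussianMoment v a b := by
  unfold gaussianMoment
  rcases eq_or_ne v 0 with rfl | hv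
  · rw [complexGaussian_zero, integral_dirac]
    rcases eq_or_ne a b with rfl | hab
    · rcases a.eq_zero_or_pos with rfl | ha
      · simp
      · simp [ha.ne']
    · rw [if_neg hab]
      rcases a.eq_zero_or_pos with rfl | ha
      · simp [hab.symm]
      · simp [ha.ne']
  rw [integral_complexGaussian hv]
  split_ifs with hab
  · subst hab
    have h := Complex.integral_rpow_mul_exp_neg_mul_rpow (p := 2) (q := 2 * a) (b := (v : ℝ)⁻¹)
      (by norm_num) (by linarith [a.cast_nonneg (α := ℝ)]) (by positivity)
    have hz : ∀ z : ℂ, ((Real.pi * v)⁻¹ * Real.exp (-(v : ℝ)⁻¹ * ‖z‖ ^ 2)) •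
        (z ^ a * (starRingEnd ℂ z) ^ a) = (((Real.pi * v)⁻¹ *
          (‖z‖ ^ (2 * a : ℝ) * Real.exp (-(v : ℝ)⁻¹ * ‖z‖ ^ (2 : ℝ))) : ℝ) : ℂ) := by
      intro z
      rw [← mul_pow, Complex.mul_conj, Complex.normSq_eq_norm_sq, Complex.real_smul,
        Real.rpow_mul (norm_nonneg _), Real.rpow_natCast, Real.rpow_two]
      push_cast
      ring
    simp_rw [hz]
    rw [integral_complex_ofReal, integral_const_mul, h]
    have h2 : (2 * (a : ℝ) + 2) / 2 = a + 1 := by ring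
    have hv' : (v : ℝ) ≠ 0 := by simpa using hv
    rw [neg_div, h2, Real.Gamma_nat_eq_factorial, Real.rpow_neg (by positivity),
      Real.inv_rpow (by positivity), inv_inv, Real.rpow_add_one hv', Real.rpow_natCast]
    rw [show (Real.pi * v)⁻¹ * (2 * Real.pi / 2 * ((v : ℝ) ^ a * v) * (a.factorial : ℝ)) =
      a.factorial * (v : ℝ) ^ a by field_simp]
    push_cast
    rfl
  · obtain ⟨u, hu⟩ : ∃ u : Circle, (u : ℂ) ^ a * (starRingEnd ℂ (u : ℂ)) ^ b ≠ 1 := by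
      refine ⟨Circle.exp 1, ?_⟩
      intro h
      apply hab
      rw [Circle.coe_exp, ← Complex.exp_conj, ← Complex.exp_nat_mul, ← Complex.exp_nat_mul,
        ← Complex.exp_add, Complex.exp_eq_one_iff] at h
      obtain ⟨n, hn⟩ := h
      have hn' : (a : ℝ) - b = n * (2 * Real.pi) := by
        have := congrArg Complex.im hn
        simpa [sub_eq_add_neg] using this
      by_contra hne
      have hn0 : n ≠ 0 := by
        rintro rfl
        apply hne
        have : (a : ℝ) = b := by simpa [sub_eq_zero] using hn'
        exact_mod_cast this
      refine irrational_pi ⟨((a : ℚ) - b) / (2 * n), ?_⟩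
      have : (n : ℝ) ≠ 0 := by exact_mod_cast hn0
      push_cast
      rw [hn']
      field_simp
    set F : ℂ → ℂ := fun z => ((Real.pi * v)⁻¹ * Real.exp (-(v : ℝ)⁻¹ * ‖z‖ ^ 2)) •
      (z ^ a * (starRingEnd ℂ z) ^ b) with hF
    have h1 : ∫ z, F (rotation u z) = ∫ z, F z :=
      ((rotation u).measurePreserving).integral_comp
        (rotation u).toHomeomorph.measurableEmbedding F
    have h2 : ∀ z, F (rotation u z) = ((u : ℂ) ^ a * (starRingEnd ℂ (u : ℂ)) ^ b) * F z := by
      intro z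
      simp only [hF, rotation_apply, norm_mul, Circle.norm_coe, one_mul, map_mul, mul_pow,
        Complex.real_smul]
      ring
    simp_rw [h2] at h1
    rw [integral_const_mul] at h1
    by_contra hne
    exact hu (mul_right_cancel₀ hne (by rw [h1, one_mul]))

instance isGaussian_complexGaussian (v : ℝ≥0) : IsGaussian (complexGaussian v) := by
  let L : ℝ × ℝ →L[ℝ] ℂ := Complex.ofRealCLM.comp (ContinuousLinearMap.fst ℝ ℝ ℝ) +
    Complex.I • (Complex.ofRealCLM.comp (ContinuousLinearMap.snd ℝ ℝ ℝ))
  have : (fun p : ℝ × ℝ => (p.1 : ℂ) + (p.2 : ℂ) * Complex.I) = L := by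
    ext p; simp [L, mul_comm]
  rw [complexGaussian, this]
  infer_instance

lemma memLp_id_complexGaussian (v : ℝ≥0) (p : ENNReal) (hp : p ≠ ⊤) :
    MemLp id p (complexGaussian v) := IsGaussian.memLp_id _ p hp

instance isGaussian_pi_complexGaussian {m : ℕ} (v : Fin m → ℝ≥0) :
    IsGaussian (Measure.pi fun i => complexGaussian (v i)) := by
  have h : HasGaussianLaw (fun ω : Fin m → ℂ => (fun i => ω i))
      (Measure.pi fun i => complexGaussian (v i)) := by
    refine iIndepFun.hasGaussianLaw (X := fun i (ω : Fin m → ℂ) => ω i) (fun i => ⟨?_⟩) ?_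
    · have := (measurePreserving_eval (fun i => complexGaussian (v i)) i).map_eq
      change Measure.map (fun ω : Fin m → ℂ => ω i) _ = _ at this
      rw [this]; infer_instance
    · exact iIndepFun_pi (X := fun _ z => z) (fun i => by fun_prop)
  have := h.isGaussian_map
  simpa using this

lemma prod_comp_eq_prod_pow_card {V I R : Type*} [Fintype V] [Fintype I] [DecidableEq V]
    [CommMonoid R] (x : I → V) (f : V → R) :
    ∏ i, f (x i) = ∏ v, f v ^ Fintype.card {i // x i = v} := by
  rw [← Fintype.prod_fiberwise' x f]
  simp

lemma sum_equiv_prod_ite_eq {V I J : Type*} [Fintype V] [Fintype I] [Fintype J] [DecidableEq V]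
    [DecidableEq I] [DecidableEq J] (s : V → ℝ≥0) (x : I → V) (y : J → V) :
    ∑ π : I ≃ J, ∏ i, (if x i = y (π i) then (s (x i) : ℂ) else 0) =
      ∏ v, gaussianMoment (s v) (Fintype.card {i // x i = v}) (Fintype.card {j // y j = v}) := by
  have h1 : ∀ π : I ≃ J, ∏ i, (if x i = y (π i) then (s (x i) : ℂ) else 0) =
      if y ∘ π = x then ∏ v, (s v : ℂ) ^ Fintype.card {i // x i = v} else 0 := by
    intro π
    rw [← prod_comp_eq_prod_pow_card x (fun v => (s v : ℂ))]
    split_ifs with h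
    · refine Finset.prod_congr rfl fun i _ => if_pos ?_
      rw [← congrFun h i]; rfl
    · obtain ⟨i, hi⟩ := Function.ne_iff.1 h
      exact Finset.prod_eq_zero (Finset.mem_univ i) (if_neg fun h' => hi h'.symm)
  simp_rw [h1]
  rw [← Finset.sum_filter, Finset.sum_const, nsmul_eq_mul]
  by_cases hex : ∃ π : I ≃ J, y ∘ π = x
  · obtain ⟨π, hπ⟩ := hex
    have hcard : ∀ v, Fintype.card {i // x i = v} = Fintype.card {j // y j = v} := fun v =>
      Fintype.card_congr (π.subtypeEquiv fun i => by rw [← hπ]; rfl)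
    have hst : (Finset.univ.filter fun ρ : I ≃ J => y ∘ ρ = x).card =
        ∏ v, (Fintype.card {i // x i = v}).factorial := by
      rw [← DomMulAct.stabilizer_card x, ← Fintype.card_subtype]
      refine Fintype.card_congr ((Equiv.equivCongr (Equiv.refl I) π.symm).subtypeEquiv fun ρ => ?_)
      have : x ∘ (Equiv.equivCongr (Equiv.refl I) π.symm ρ) = y ∘ ρ := by
        ext i; simp [← hπ]
      rw [this]
    rw [hst]
    simp only [gaussianMoment, hcard, if_true, Finset.prod_mul_distrib]
    push_cast
    rfl
  · have hst : (Finset.univ.filter fun ρ : I ≃ J => y ∘ ρ = x) = ∅ := by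
      refine Finset.filter_eq_empty_iff.2 fun ρ _ h => hex ⟨ρ, h⟩
    obtain ⟨v, hv⟩ : ∃ v, Fintype.card {i // x i = v} ≠ Fintype.card {j // y j = v} := by
      by_contra! h
      exact hex ⟨Equiv.ofFiberEquiv (f := x) (g := y) fun v => Fintype.equivOfCardEq (h v), by
        ext i; exact Equiv.ofFiberEquiv_map _ _⟩
    rw [hst, Finset.card_empty, Nat.cast_zero, zero_mul]
    exact (Finset.prod_eq_zero (Finset.mem_univ v) (if_neg hv)).symm

section Wick

variable {Ω ι I J : Type*} [MeasurableSpace Ω] {μ : Measure Ω} [Fintype I] [Fintype J]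

lemma integral_prod_mul_prod_conj_of_fintype [Fintype ι] [DecidableEq ι] [DecidableEq I]
    [DecidableEq J] {X : ι → Ω → ℂ} {s : ι → ℝ≥0}
    (hX : ∀ v, HasLaw (X v) (complexGaussian (s v)) μ) (hind : iIndepFun X μ)
    (x : I → ι) (y : J → ι) :
    ∫ ω, (∏ i, X (x i) ω) * ∏ j, starRingEnd ℂ (X (y j) ω) ∂μ =
      ∑ π : I ≃ J, ∏ i, if x i = y (π i) then (s (x i) : ℂ) else 0 := by
  rw [sum_equiv_prod_ite_eq]
  have h1 : ∀ ω, (∏ i, X (x i) ω) * ∏ j, starRingEnd ℂ (X (y j) ω) =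
      ∏ v, (fun z : ℂ => z ^ Fintype.card {i // x i = v} *
        (starRingEnd ℂ z) ^ Fintype.card {j // y j = v}) (X v ω) := by
    intro ω
    rw [prod_comp_eq_prod_pow_card x (fun v => X v ω),
      prod_comp_eq_prod_pow_card y (fun v => starRingEnd ℂ (X v ω)), ← Finset.prod_mul_distrib]
  simp_rw [h1]
  have hcont : ∀ a b : ℕ, Continuous fun z : ℂ => z ^ a * (starRingEnd ℂ z) ^ b := fun a b =>
    (continuous_pow a).mul (Complex.continuous_conj.pow b)
  rw [hind.integral_fun_prod_comp (f := fun v (z : ℂ) => z ^ Fintype.card {i // x i = v} *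
        (starRingEnd ℂ z) ^ Fintype.card {j // y j = v}) (fun v => (hX v).aemeasurable)
      (fun v => (hcont _ _).aestronglyMeasurable)]
  refine Finset.prod_congr rfl fun v _ => ?_
  rw [← integral_complexGaussian_moment, ← (hX v).map_eq,
    integral_map (hX v).aemeasurable (hcont _ _).aestronglyMeasurable]

/-- **Wick's formula** for independent complex Gaussian variables. -/
theorem integral_prod_mul_prod_conj [DecidableEq ι] [DecidableEq I] [DecidableEq J]
    {X : ι → Ω → ℂ} {s : ι → ℝ≥0}
    (hX : ∀ v, HasLaw (X v) (complexGaussian (s v)) μ) (hind : iIndepFun X μ)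
    (x : I → ι) (y : J → ι) :
    ∫ ω, (∏ i, X (x i) ω) * ∏ j, starRingEnd ℂ (X (y j) ω) ∂μ =
      ∑ π : I ≃ J, ∏ i, if x i = y (π i) then (s (x i) : ℂ) else 0 := by
  let T : Finset ι := Finset.univ.image x ∪ Finset.univ.image y
  let x' : I → T := fun i => ⟨x i, by simp [T]⟩
  let y' : J → T := fun j => ⟨y j, by simp [T]⟩
  have := integral_prod_mul_prod_conj_of_fintype (X := fun v : T => X v) (s := fun v : T => s v)
    (fun v => hX v) (hind.precomp Subtype.val_injective) x' y'
  simpa [x', y', Subtype.ext_iff] using this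

end Wick

/-- Functions all of whose absolute moments are finite. -/
def HasFiniteMoments {Ω : Type*} [MeasurableSpace Ω] (f : Ω → ℂ) (μ : Measure Ω) : Prop :=
  ∀ p : ℝ≥0, MemLp f p μ

namespace HasFiniteMoments

variable {Ω ι : Type*} [MeasurableSpace Ω] {μ : Measure Ω} {f g : Ω → ℂ}

lemma mul (hf : HasFiniteMoments f μ) (hg : HasFiniteMoments g μ) :
    HasFiniteMoments (fun ω => f ω * g ω) μ := by
  intro p
  have : ENNReal.HolderTriple ((2 * p : ℝ≥0) : ENNReal) ((2 * p : ℝ≥0) : ENNReal) p := by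
    constructor
    push_cast
    rw [← two_mul, ENNReal.mul_inv (by simp) (by simp), ← mul_assoc,
      ENNReal.mul_inv_cancel (by simp) (by simp), one_mul]
  exact (hg (2 * p)).mul (hf (2 * p))

lemma const [IsFiniteMeasure μ] (c : ℂ) : HasFiniteMoments (fun _ => c) μ := fun _ => memLp_const c

lemma sum (s : Finset ι) {f : ι → Ω → ℂ} (hf : ∀ i ∈ s, HasFiniteMoments (f i) μ) :
    HasFiniteMoments (fun ω => ∑ i ∈ s, f i ω) μ :=
  fun p => memLp_finsetSum s fun i hi => hf i hi p

lemma prod [IsFiniteMeasure μ] (s : Finset ι) {f : ι → Ω → ℂ}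
    (hf : ∀ i ∈ s, HasFiniteMoments (f i) μ) :
    HasFiniteMoments (fun ω => ∏ i ∈ s, f i ω) μ := by
  classical
  induction s using Finset.induction_on with
  | empty => simpa using const 1
  | insert a s ha ih =>
    simp only [Finset.prod_insert ha]
    exact (hf a (Finset.mem_insert_self a s)).mul
      (ih fun i hi => hf i (Finset.mem_insert_of_mem hi))

lemma conj (hf : HasFiniteMoments f μ) : HasFiniteMoments (fun ω => starRingEnd ℂ (f ω)) μ :=
  fun p => (hf p).star

lemma integrable (hf : HasFiniteMoments f μ) : Integrable f μ :=
  memLp_one_iff_integrable.1 (by simpa using hf 1)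

lemma of_hasLaw {v : ℝ≥0} (hf : HasLaw f (complexGaussian v) μ) : HasFiniteMoments f μ := by
  intro p
  have h := memLp_id_complexGaussian v p (by simp)
  rw [← hf.map_eq] at h
  exact h.comp_of_map hf.aemeasurable

end HasFiniteMoments

lemma norm_exp_mul_I_sub_sum_le (n : ℕ) (x : ℝ) :
    ‖Complex.exp (x * Complex.I) - ∑ m ∈ Finset.range n, (x * Complex.I) ^ m / m.factorial‖ ≤
      |x| ^ n / n.factorial := by
  have key : ∀ n : ℕ, ∀ x : ℝ, 0 ≤ x →
      ‖Complex.exp (x * Complex.I) - ∑ m ∈ Finset.range n, (x * Complex.I) ^ m / m.factorial‖ ≤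
        x ^ n / n.factorial := by
    intro n
    induction n with
    | zero => intro x _; simp [Complex.norm_exp_ofReal_mul_I]
    | succ n ih =>
      intro x hx
      have hderiv : ∀ y : ℝ, HasDerivAt (fun y : ℝ => Complex.exp (y * Complex.I) -
          ∑ m ∈ Finset.range (n + 1), (y * Complex.I) ^ m / m.factorial)
          (Complex.I * (Complex.exp (y * Complex.I) -
            ∑ m ∈ Finset.range n, (y * Complex.I) ^ m / m.factorial)) y := by
        intro y
        have hb : HasDerivAt (fun y : ℝ => (y : ℂ) * Complex.I) Complex.I y := by
          simpa using (Complex.ofRealCLM.hasDerivAt (x := y)).mul_const Complex.I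
        have hs : HasDerivAt (fun y : ℝ => ∑ m ∈ Finset.range (n + 1),
            ((y : ℂ) * Complex.I) ^ m / m.factorial)
            (∑ m ∈ Finset.range (n + 1),
              (m * ((y : ℂ) * Complex.I) ^ (m - 1) * Complex.I) / m.factorial) y :=
          HasDerivAt.fun_sum fun m _ => (hb.pow m).div_const _
        refine (hb.cexp.sub hs).congr_deriv ?_
        rw [Finset.sum_range_succ']
        simp only [Nat.cast_zero, zero_mul, zero_div, add_zero, mul_sub, Finset.mul_sum]
        congr 1
        · ring
        · refine Finset.sum_congr rfl fun m _ => ?_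
          rw [Nat.add_sub_cancel, Nat.factorial_succ]
          have h1 : ((m : ℂ) + 1) ≠ 0 := by exact_mod_cast m.succ_ne_zero
          have h2 : (m.factorial : ℂ) ≠ 0 := by exact_mod_cast m.factorial_ne_zero
          push_cast
          field_simp
      have hB : ∀ y : ℝ, HasDerivAt (fun y : ℝ => y ^ (n + 1) / (n + 1).factorial)
          (y ^ n / n.factorial) y := by
        intro y
        refine ((hasDerivAt_pow (n + 1) y).div_const _).congr_deriv ?_
        rw [Nat.add_sub_cancel, Nat.factorial_succ]
        push_cast
        field_simp
      refine image_norm_le_of_norm_deriv_right_le_deriv_boundary (a := 0) (b := x)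
        (fun y _ => (hderiv y).continuousAt.continuousWithinAt)
        (fun y _ => (hderiv y).hasDerivWithinAt) ?_ hB (fun y hy => ?_) ⟨hx, le_rfl⟩
      · simp [Finset.sum_range_succ']
      · rw [norm_mul, Complex.norm_I, one_mul]
        exact ih y hy.1
  rcases le_total 0 x with hx | hx
  · simpa [abs_of_nonneg hx] using key n x hx
  · have h := key n (-x) (by linarith)
    rw [abs_of_nonpos hx, ← RCLike.norm_conj]
    convert! h using 2
    simp only [map_sub, map_sum, map_div₀, map_pow, map_mul, Complex.conj_ofReal, Complex.conj_I,
      ← Complex.exp_conj, map_natCast, Complex.ofReal_neg]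
    simp only [mul_neg, neg_mul]

section MomentMethod

lemma norm_integral_exp_sub_sum_le {Ω : Type*} [MeasurableSpace Ω] {μ : Measure Ω}
    [IsProbabilityMeasure μ] {X : Ω → ℝ} (hX : ∀ k : ℕ, Integrable (fun ω => X ω ^ k) μ) (n : ℕ) :
    ‖∫ ω, Complex.exp (X ω * Complex.I) ∂μ - ∑ k ∈ Finset.range (2 * n),
      Complex.I ^ k / k.factorial * ((∫ ω, X ω ^ k ∂μ : ℝ) : ℂ)‖ ≤
      (∫ ω, X ω ^ (2 * n) ∂μ) / (2 * n).factorial := by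
  have hXm : AEStronglyMeasurable X μ := by simpa using (hX 1).aestronglyMeasurable
  have hexp : Integrable (fun ω => Complex.exp (X ω * Complex.I)) μ := by
    refine Integrable.of_bound (C := 1) ?_ (ae_of_all _ fun ω => ?_)
    · exact Continuous.comp_aestronglyMeasurable
        (g := fun x : ℝ => Complex.exp (x * Complex.I)) (by fun_prop) hXm
    · rw [Complex.norm_exp_ofReal_mul_I]
  have hterm : ∀ k : ℕ, Integrable (fun ω => (X ω * Complex.I) ^ k / k.factorial) μ := by
    intro k
    have := ((hX k).ofReal (𝕜 := ℂ)).const_mul (Complex.I ^ k / k.factorial)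
    refine this.congr (ae_of_all _ fun ω => ?_)
    push_cast
    simp only [Complex.coe_algebraMap]
    ring
  have hsum : ∑ k ∈ Finset.range (2 * n),
      Complex.I ^ k / k.factorial * ((∫ ω, X ω ^ k ∂μ : ℝ) : ℂ) =
      ∫ ω, ∑ k ∈ Finset.range (2 * n), (X ω * Complex.I) ^ k / k.factorial ∂μ := by
    rw [integral_finsetSum _ fun k _ => hterm k]
    refine Finset.sum_congr rfl fun k _ => ?_
    rw [← integral_complex_ofReal, ← integral_const_mul]
    congr 1
    ext ω
    push_cast
    ring
  rw [hsum, ← integral_sub hexp (integrable_finsetSum _ fun k _ => hterm k), ← integral_div]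
  refine (norm_integral_le_integral_norm _).trans (integral_mono ?_ ?_ fun ω => ?_)
  · exact (hexp.sub (integrable_finsetSum _ fun k _ => hterm k)).norm
  · exact (hX _).div_const _
  · refine (norm_exp_mul_I_sub_sum_le (2 * n) (X ω)).trans_eq ?_
    rw [(even_two_mul n).pow_abs]

lemma tendsto_integral_pow_div_factorial {Ω : Type*} [MeasurableSpace Ω] {ν : Measure Ω}
    {Y : Ω → ℝ} (hYm : AEStronglyMeasurable Y ν) (hY : Integrable (fun ω => Real.exp |Y ω|) ν) :
    Tendsto (fun n : ℕ => (∫ ω, Y ω ^ (2 * n) ∂ν) / (2 * n).factorial) atTop (𝓝 0) := by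
  simp_rw [← integral_div]
  rw [← integral_zero Ω ℝ (μ := ν)]
  refine tendsto_integral_of_dominated_convergence (fun ω => Real.exp |Y ω|)
    (fun n => by simpa [div_eq_mul_inv] using (hYm.pow (2 * n)).mul_const _) hY
    (fun n => ae_of_all _ fun ω => ?_)
    (ae_of_all _ fun ω => ?_)
  · rw [norm_div, norm_pow, Real.norm_eq_abs, Real.norm_natCast]
    exact Real.pow_div_factorial_le_exp _ (abs_nonneg _) _
  · exact (FloorSemiring.tendsto_pow_div_factorial_atTop (Y ω)).comp
      (tendsto_id.const_mul_atTop' two_pos)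

/-- **The method of moments** for characteristic functions, with a limit that has an exponential
moment. -/
theorem tendsto_integral_exp_of_tendsto_moments {Ω : ℕ → Type*} [∀ N, MeasurableSpace (Ω N)]
    {μ : ∀ N, Measure (Ω N)} [∀ N, IsProbabilityMeasure (μ N)] {X : ∀ N, Ω N → ℝ}
    (hX : ∀ N (k : ℕ), Integrable (fun ω => X N ω ^ k) (μ N))
    {Ω' : Type*} [MeasurableSpace Ω'] {ν : Measure Ω'} [IsProbabilityMeasure ν] {Y : Ω' → ℝ}
    (hYm : AEStronglyMeasurable Y ν) (hY : Integrable (fun ω => Real.exp |Y ω|) ν)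
    (hmom : ∀ k : ℕ, Tendsto (fun N => ∫ ω, X N ω ^ k ∂μ N) atTop (𝓝 (∫ ω, Y ω ^ k ∂ν))) :
    Tendsto (fun N => ∫ ω, Complex.exp (X N ω * Complex.I) ∂μ N) atTop
      (𝓝 (∫ ω, Complex.exp (Y ω * Complex.I) ∂ν)) := by
  have hYk : ∀ k : ℕ, Integrable (fun ω => Y ω ^ k) ν := by
    intro k
    refine (hY.const_mul (k.factorial : ℝ)).mono' (hYm.pow k) (ae_of_all _ fun ω => ?_)
    rw [norm_pow, Real.norm_eq_abs, ← div_le_iff₀' (by positivity)]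
    exact Real.pow_div_factorial_le_exp _ (abs_nonneg _) _
  rw [Metric.tendsto_atTop]
  intro ε hε
  obtain ⟨n, hn⟩ := ((tendsto_integral_pow_div_factorial hYm hY).eventually
    (gt_mem_nhds (show 0 < ε / 4 by positivity))).exists
  have h1 : Tendsto (fun N => (∫ ω, X N ω ^ (2 * n) ∂μ N) / (2 * n).factorial) atTop
      (𝓝 ((∫ ω, Y ω ^ (2 * n) ∂ν) / (2 * n).factorial)) := (hmom _).div_const _
  have h2 : Tendsto (fun N => ∑ k ∈ Finset.range (2 * n),
      Complex.I ^ k / k.factorial * ((∫ ω, X N ω ^ k ∂μ N : ℝ) : ℂ)) atTop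
      (𝓝 (∑ k ∈ Finset.range (2 * n),
        Complex.I ^ k / k.factorial * ((∫ ω, Y ω ^ k ∂ν : ℝ) : ℂ))) :=
    tendsto_finsetSum _ fun k _ =>
      ((Complex.continuous_ofReal.tendsto _).comp (hmom k)).const_mul _
  obtain ⟨N₀, hN₀⟩ := eventually_atTop.1 ((h1.eventually (gt_mem_nhds hn)).and
    (Metric.tendsto_nhds.1 h2 (ε / 4) (by positivity)))
  refine ⟨N₀, fun N hN => ?_⟩
  obtain ⟨ha, hb⟩ := hN₀ N hN
  have hc := norm_integral_exp_sub_sum_le (hX N) n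
  have hd := norm_integral_exp_sub_sum_le hYk n
  rw [← dist_eq_norm] at hc hd
  rw [dist_comm] at hd
  have h3 := lt_of_le_of_lt (dist_triangle _ _ _) (add_lt_add (hc.trans_lt ha) hb)
  have h4 := lt_of_le_of_lt (dist_triangle _ _ _) (add_lt_add h3 (hd.trans_lt hn))
  linarith

variable {m : ℕ}

lemma ofReal_inner_eq_sum (z t : EuclideanSpace ℂ (Fin m)) :
    ((inner ℝ z t : ℝ) : ℂ) = ∑ a : Fin m × Bool,
      (if a.2 then t a.1 / 2 else starRingEnd ℂ (t a.1) / 2) *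
        (if a.2 then starRingEnd ℂ (z a.1) else z a.1) := by
  rw [PiLp.inner_apply, Fintype.sum_prod_type]
  push_cast
  refine Finset.sum_congr rfl fun l _ => ?_
  simp only [Fintype.sum_bool, if_true, Bool.false_eq_true, if_false]
  apply Complex.ext <;> simp [Complex.inner] <;> ring

lemma prod_ite_conj_eq {k : ℕ} (f : Fin k → Fin m × Bool) (z : Fin m → ℂ) :
    ∏ i, (if (f i).2 then starRingEnd ℂ (z (f i).1) else z (f i).1) =
      (∏ i : {i // (f i).2 = false}, z (f i).1) *
        ∏ i : {i // ¬ (f i).2 = false}, starRingEnd ℂ (z (f i).1) := by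
  rw [← Fintype.prod_subtype_mul_prod_subtype (fun i => (f i).2 = false)]
  congr 1
  · exact Finset.prod_congr rfl fun i _ => by simp [i.2]
  · exact Finset.prod_congr rfl fun i _ => by simp [Bool.eq_true_of_not_eq_false i.2]

lemma ofReal_integral_inner_pow {Ω : Type*} [MeasurableSpace Ω] {μ : Measure Ω}
    [IsProbabilityMeasure μ] {T : Ω → Fin m → ℂ}
    (hT : ∀ l, HasFiniteMoments (fun ω => T ω l) μ) (t : EuclideanSpace ℂ (Fin m)) (k : ℕ) :
    ((∫ ω, (inner ℝ (WithLp.toLp 2 (T ω)) t : ℝ) ^ k ∂μ : ℝ) : ℂ) =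
      ∑ f : Fin k → Fin m × Bool,
        (∏ i, (if (f i).2 then t (f i).1 / 2 else starRingEnd ℂ (t (f i).1) / 2)) *
        ∫ ω, (∏ i : {i // (f i).2 = false}, T ω (f i).1) *
          ∏ i : {i // ¬ (f i).2 = false}, starRingEnd ℂ (T ω (f i).1) ∂μ := by
  rw [← integral_complex_ofReal]
  simp_rw [Complex.ofReal_pow, ofReal_inner_eq_sum, Fintype.sum_pow, Finset.prod_mul_distrib,
    prod_ite_conj_eq]
  rw [integral_finsetSum]
  · exact Finset.sum_congr rfl fun f _ => integral_const_mul _ _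
  · intro f _
    exact ((HasFiniteMoments.const _).mul ((HasFiniteMoments.prod _ fun i _ => hT _).mul
      (HasFiniteMoments.prod _ fun i _ => (hT _).conj))).integrable

lemma integrable_inner_pow {Ω : Type*} [MeasurableSpace Ω] {μ : Measure Ω}
    [IsProbabilityMeasure μ] {T : Ω → Fin m → ℂ}
    (hT : ∀ l, HasFiniteMoments (fun ω => T ω l) μ) (t : EuclideanSpace ℂ (Fin m)) (k : ℕ) :
    Integrable (fun ω => (inner ℝ (WithLp.toLp 2 (T ω)) t : ℝ) ^ k) μ := by
  have h : HasFiniteMoments (fun ω => ∏ _i : Fin k,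
      ((inner ℝ (WithLp.toLp 2 (T ω)) t : ℝ) : ℂ)) μ := by
    refine HasFiniteMoments.prod _ fun _ _ => ?_
    simp_rw [ofReal_inner_eq_sum]
    refine HasFiniteMoments.sum _ fun a _ => (HasFiniteMoments.const _).mul ?_
    split_ifs
    exacts [(hT _).conj, hT _]
  refine h.integrable.re.congr (ae_of_all _ fun ω => ?_)
  simp [← Complex.ofReal_pow]

/-- **The method of moments** in `ℂ ^ m`, with a Gaussian limit. -/
theorem tendstoInDistribution_of_tendsto_moments {Ω : ℕ → Type*} [∀ N, MeasurableSpace (Ω N)]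
    {μ : ∀ N, Measure (Ω N)} [∀ N, IsProbabilityMeasure (μ N)] {T : ∀ N, Ω N → Fin m → ℂ}
    (hT : ∀ N l, HasFiniteMoments (fun ω => T N ω l) (μ N))
    {ν : Measure (Fin m → ℂ)} [IsGaussian ν]
    (hmom : ∀ (I J : Type) [Fintype I] [Fintype J] (x : I → Fin m) (y : J → Fin m),
      Tendsto (fun N => ∫ ω, (∏ i, T N ω (x i)) * ∏ j, starRingEnd ℂ (T N ω (y j)) ∂μ N) atTop
        (𝓝 (∫ z, (∏ i, z (x i)) * ∏ j, starRingEnd ℂ (z (y j)) ∂ν))) :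
    TendstoInDistribution T atTop (fun z : Fin m → ℂ => z) μ ν := by
  have hTm : ∀ N, AEMeasurable (T N) (μ N) := fun N =>
    aemeasurable_pi_iff.2 fun l => (hT N l 0).aestronglyMeasurable.aemeasurable
  have hν : ∀ l, HasFiniteMoments (fun z : Fin m → ℂ => z l) ν := fun l p =>
    (ContinuousLinearMap.proj (R := ℝ) (φ := fun _ : Fin m => ℂ) l).comp_memLp'
      (IsGaussian.memLp_id ν p (by simp))
  have hmeas : Measurable (WithLp.toLp 2 : (Fin m → ℂ) → EuclideanSpace ℂ (Fin m)) := by fun_prop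
  suffices h : TendstoInDistribution (fun N ω => (WithLp.toLp 2 (T N ω) : EuclideanSpace ℂ (Fin m)))
      atTop (fun z : Fin m → ℂ => (WithLp.toLp 2 z : EuclideanSpace ℂ (Fin m))) μ ν from
    h.continuous_comp (g := WithLp.ofLp) (by fun_prop)
  refine ⟨fun N => hmeas.comp_aemeasurable (hTm N), hmeas.aemeasurable, ?_⟩
  refine (ProbabilityMeasure.tendsto_iff_tendsto_charFun
    (E := EuclideanSpace ℂ (Fin m))).2 fun t => ?_
  have hcont : Continuous fun z : EuclideanSpace ℂ (Fin m) =>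
      Complex.exp ((inner ℝ z t : ℝ) * Complex.I) := by fun_prop
  change Tendsto (fun N => ∫ z : EuclideanSpace ℂ (Fin m),
      Complex.exp ((inner ℝ z t : ℝ) * Complex.I) ∂(μ N).map fun ω => WithLp.toLp 2 (T N ω)) atTop
    (𝓝 (∫ z : EuclideanSpace ℂ (Fin m), Complex.exp ((inner ℝ z t : ℝ) * Complex.I)
      ∂ν.map fun z => WithLp.toLp 2 z))
  rw [integral_map hmeas.aemeasurable hcont.aestronglyMeasurable]
  refine Tendsto.congr (fun N => (integral_map (hmeas.comp_aemeasurable (hTm N))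
    hcont.aestronglyMeasurable).symm) ?_
  have hlin : Continuous fun z : Fin m → ℂ =>
      (inner ℝ (WithLp.toLp 2 z : EuclideanSpace ℂ (Fin m)) t : ℝ) := by fun_prop
  refine tendsto_integral_exp_of_tendsto_moments (fun N k => integrable_inner_pow (hT N) t k)
    hlin.aestronglyMeasurable ?_ fun k => ?_
  · let L : (Fin m → ℂ) →L[ℝ] ℝ := (innerSL ℝ t).comp
      ((PiLp.continuousLinearEquiv 2 ℝ (fun _ : Fin m => ℂ)).symm : (Fin m → ℂ) →L[ℝ] _)
    obtain ⟨C, hC, hint⟩ := IsGaussian.exists_integrable_exp_sq ν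
    refine (hint.const_mul (Real.exp (‖L‖ ^ 2 / (4 * C)))).mono'
      (Real.continuous_exp.comp (continuous_abs.comp hlin)).aestronglyMeasurable
      (ae_of_all _ fun z => ?_)
    rw [Real.norm_of_nonneg (Real.exp_pos _).le, ← Real.exp_add, Real.exp_le_exp]
    have h1 : |(inner ℝ (WithLp.toLp 2 z : EuclideanSpace ℂ (Fin m)) t : ℝ)| ≤ ‖L‖ * ‖z‖ := by
      rw [real_inner_comm]
      exact L.le_opNorm z
    refine h1.trans ?_
    have h2 : ‖L‖ ^ 2 / (4 * C) + C * ‖z‖ ^ 2 - ‖L‖ * ‖z‖ =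
        (‖L‖ - 2 * C * ‖z‖) ^ 2 / (4 * C) := by
      field_simp
      ring
    have h3 : 0 ≤ (‖L‖ - 2 * C * ‖z‖) ^ 2 / (4 * C) := by positivity
    linarith
  · have h : Tendsto (fun N =>
        ((∫ ω, (inner ℝ (WithLp.toLp 2 (T N ω)) t : ℝ) ^ k ∂μ N : ℝ) : ℂ)) atTop
        (𝓝 ((∫ z, (inner ℝ (WithLp.toLp 2 z) t : ℝ) ^ k ∂ν : ℝ) : ℂ)) := by
      simp_rw [fun N => ofReal_integral_inner_pow (hT N) t k]
      rw [ofReal_integral_inner_pow (T := fun z => z) hν t k]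
      exact tendsto_finsetSum _ fun f _ => (hmom _ _ _ _).const_mul _
    exact (Complex.continuous_re.tendsto _).comp h

end MomentMethod

section Counting

variable {A B : Type*} [Fintype A] [Fintype B] [DecidableEq A] [DecidableEq B]

/-- Unless `f = g`, the condition `p ∘ f = p ∘ g` on `p : A → Fin N` removes at least one degree of
freedom. -/
lemma card_forall_comp_eq_le {f g : A → A} (hfg : f ≠ g) (N : ℕ) :
    Fintype.card {p : A → Fin N // ∀ a, p (f a) = p (g a)} ≤ N ^ (Fintype.card A - 1) := by
  obtain ⟨a, ha⟩ := Function.ne_iff.1 hfg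
  have hinj : Function.Injective
      fun (p : {p : A → Fin N // ∀ a, p (f a) = p (g a)}) (b : {b // b ≠ f a}) => p.1 b := by
    intro p q hpq
    have h : ∀ b, b ≠ f a → p.1 b = q.1 b := fun b hb => congrFun hpq ⟨b, hb⟩
    refine Subtype.ext (funext fun b => ?_)
    by_cases hb : b = f a
    · rw [hb, p.2, q.2, h _ ha.symm]
    · exact h b hb
  refine (Fintype.card_le_of_injective _ hinj).trans_eq ?_
  rw [Fintype.card_fun, Fintype.card_fin, Fintype.card_subtype_compl, Fintype.card_subtype_eq]

lemma tendsto_card_forall_comp_eq (f g : A → A) :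
    Tendsto (fun N : ℕ => (Fintype.card {p : A → Fin N // ∀ a, p (f a) = p (g a)} : ℂ) *
      (((1 / N : ℝ≥0) : ℝ) : ℂ) ^ Fintype.card A) atTop (𝓝 (if f = g then 1 else 0)) := by
  split_ifs with hfg
  · refine tendsto_const_nhds.congr' ?_
    filter_upwards [eventually_gt_atTop 0] with N hN
    have hN' : (N : ℂ) ≠ 0 := by exact_mod_cast hN.ne'
    have hcard : Fintype.card {p : A → Fin N // ∀ a, p (f a) = p (g a)} = N ^ Fintype.card A := by
      rw [Fintype.card_congr (Equiv.subtypeUnivEquiv fun p a => by rw [hfg]), Fintype.card_fun,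
        Fintype.card_fin]
    rw [hcard]
    push_cast
    rw [← mul_pow, mul_one_div_cancel hN', one_pow]
  · refine squeeze_zero_norm' ?_ (tendsto_inv_atTop_nhds_zero_nat (𝕜 := ℝ))
    filter_upwards [eventually_gt_atTop 0] with N hN
    have hN' : (N : ℝ) ≠ 0 := by exact_mod_cast hN.ne'
    have hA : 0 < Fintype.card A := by
      obtain ⟨a, -⟩ := Function.ne_iff.1 hfg
      exact Fintype.card_pos_iff.2 ⟨a⟩
    have h := card_forall_comp_eq_le hfg N
    have h' : (Fintype.card {p : A → Fin N // ∀ a, p (f a) = p (g a)} : ℝ) ≤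
        (N : ℝ) ^ (Fintype.card A - 1) := by exact_mod_cast h
    rw [norm_mul, norm_pow, Complex.norm_natCast, Complex.norm_real]
    push_cast
    rw [Real.norm_of_nonneg (by positivity)]
    refine (mul_le_mul_of_nonneg_right h' (by positivity)).trans_eq ?_
    obtain ⟨k, hk⟩ := Nat.exists_eq_succ_of_ne_zero hA.ne'
    rw [hk]
    simp only [Nat.succ_sub_one, one_div, inv_pow, pow_succ]
    field_simp

lemma sum_sum_prod_ite_eq {N : ℕ} (σ : A → A) (τ : B → B) (r : A → ℕ) (s : B → ℕ) (π : A ≃ B)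
    (v : ℂ) :
    ∑ p : A → Fin N, ∑ q : B → Fin N,
      ∏ a, (if (r a, p a, p (σ a)) = (s (π a), q (π a), q (τ (π a))) then v else 0) =
      if s ∘ π = r then
        (Fintype.card {p : A → Fin N // ∀ a, p (σ a) = p (π.symm (τ (π a)))} : ℂ) *
          v ^ Fintype.card A else 0 := by
  have h : ∀ (p : A → Fin N) (q : B → Fin N),
      ∏ a, (if (r a, p a, p (σ a)) = (s (π a), q (π a), q (τ (π a))) then v else 0) =
      if q = p ∘ π.symm then
        (if s ∘ π = r ∧ ∀ a, p (σ a) = p (π.symm (τ (π a))) then v ^ Fintype.card A else 0)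
      else 0 := by
    intro p q
    have h1 : ∏ a, (if (r a, p a, p (σ a)) = (s (π a), q (π a), q (τ (π a))) then v else 0) =
        if ∀ a, (r a, p a, p (σ a)) = (s (π a), q (π a), q (τ (π a)))
          then v ^ Fintype.card A else 0 := by
      simp [Finset.prod_ite_zero]
    rw [h1, ← ite_and]
    refine if_congr ?_ rfl rfl
    simp only [Prod.mk.injEq]
    constructor
    · intro h
      have hq : q = p ∘ π.symm := by
        ext b
        rw [Function.comp_apply, (h (π.symm b)).2.1, Equiv.apply_symm_apply]
      refine ⟨hq, funext fun a => ((h a).1).symm, fun a => ?_⟩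
      rw [(h a).2.2, hq, Function.comp_apply]
    · rintro ⟨rfl, hr, hp⟩ a
      exact ⟨(congrFun hr a).symm, by simp, hp a⟩
  simp_rw [h, Finset.sum_ite_eq', Finset.mem_univ, if_true]
  by_cases hr : s ∘ π = r
  · simp only [hr, true_and, if_true]
    rw [← Finset.sum_filter, Finset.sum_const, nsmul_eq_mul, Fintype.card_subtype]
  · simp [hr]

/-- Expectations of products of cycles of entries of Ginibre matrices. -/
lemma integral_sum_mul_conj_sum {Ω : Type*} [MeasurableSpace Ω] {μ : Measure Ω}
    [IsProbabilityMeasure μ] {N : ℕ} {G : ℕ → Ω → Matrix (Fin N) (Fin N) ℂ}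
    (hG : IsGinibreFamily N G μ) (σ : A → A) (τ : B → B) (r : A → ℕ) (s : B → ℕ) :
    ∫ ω, (∑ p : A → Fin N, ∏ a, G (r a) ω (p a) (p (σ a))) *
      (∑ q : B → Fin N, ∏ b, starRingEnd ℂ (G (s b) ω (q b) (q (τ b)))) ∂μ =
      ∑ π : A ≃ B, if s ∘ π = r then
        (Fintype.card {p : A → Fin N // ∀ a, p (σ a) = p (π.symm (τ (π a)))} : ℂ) *
          (((1 / N : ℝ≥0) : ℝ) : ℂ) ^ Fintype.card A else 0 := by
  have hfin : ∀ i s t, HasFiniteMoments (fun ω => G i ω s t) μ := fun i s t =>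
    HasFiniteMoments.of_hasLaw (hG.hasLaw i s t)
  have hint : ∀ (p : A → Fin N) (q : B → Fin N), HasFiniteMoments (fun ω =>
      (∏ a, G (r a) ω (p a) (p (σ a))) *
        ∏ b, starRingEnd ℂ (G (s b) ω (q b) (q (τ b)))) μ := fun p q =>
    (HasFiniteMoments.prod _ fun _ _ => hfin _ _ _).mul
      (HasFiniteMoments.prod _ fun _ _ => (hfin _ _ _).conj)
  simp_rw [Finset.sum_mul_sum]
  rw [integral_finsetSum _ fun p _ =>
    (HasFiniteMoments.sum _ fun q _ => hint p q).integrable]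
  simp_rw [fun p => integral_finsetSum (μ := μ) Finset.univ fun q _ => (hint p q).integrable]
  have hwick : ∀ (p : A → Fin N) (q : B → Fin N),
      ∫ ω, (∏ a, G (r a) ω (p a) (p (σ a))) *
        ∏ b, starRingEnd ℂ (G (s b) ω (q b) (q (τ b))) ∂μ =
      ∑ π : A ≃ B, ∏ a, if (r a, p a, p (σ a)) = (s (π a), q (π a), q (τ (π a)))
        then (((1 / N : ℝ≥0) : ℝ) : ℂ) else 0 := fun p q =>
    integral_prod_mul_prod_conj (X := fun (v : ℕ × Fin N × Fin N) ω => G v.1 ω v.2.1 v.2.2)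
      (s := fun _ => 1 / N) (fun v => hG.hasLaw _ _ _) hG.indep
      (fun a => (r a, p a, p (σ a))) (fun b => (s b, q b, q (τ b)))
  simp_rw [hwick]
  rw [Finset.sum_congr rfl fun p _ => Finset.sum_comm, Finset.sum_comm]
  exact Finset.sum_congr rfl fun π _ => sum_sum_prod_ite_eq σ τ r s π _

/-- The bijections that conjugate `σ` to `τ` and carry the labelling `r` to the labelling `s`. -/
def LabelledConj (σ : A → A) (τ : B → B) (r : A → ℕ) (s : B → ℕ) : Type _ :=
  {π : A ≃ B // s ∘ π = r ∧ ∀ a, π (σ a) = τ (π a)}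

noncomputable instance (σ : A → A) (τ : B → B) (r : A → ℕ) (s : B → ℕ) :
    Fintype (LabelledConj σ τ r s) :=
  inferInstanceAs (Fintype {π : A ≃ B // s ∘ π = r ∧ ∀ a, π (σ a) = τ (π a)})

lemma tendsto_integral_sum_mul_conj_sum {Ω : ℕ → Type*} [∀ N, MeasurableSpace (Ω N)]
    {μ : ∀ N, Measure (Ω N)} [∀ N, IsProbabilityMeasure (μ N)]
    {G : ∀ N, ℕ → Ω N → Matrix (Fin N) (Fin N) ℂ} (hG : ∀ N, IsGinibreFamily N (G N) (μ N))
    (σ : A → A) (τ : B → B) (r : A → ℕ) (s : B → ℕ) :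
    Tendsto (fun N => ∫ ω, (∑ p : A → Fin N, ∏ a, G N (r a) ω (p a) (p (σ a))) *
      (∑ q : B → Fin N, ∏ b, starRingEnd ℂ (G N (s b) ω (q b) (q (τ b)))) ∂μ N) atTop
      (𝓝 (Fintype.card (LabelledConj σ τ r s) : ℂ)) := by
  simp_rw [fun N => integral_sum_mul_conj_sum (hG N) σ τ r s]
  have hcard : (Fintype.card (LabelledConj σ τ r s) : ℂ) = ∑ π : A ≃ B, if s ∘ π = r then
      (if σ = (fun a => π.symm (τ (π a))) then 1 else 0) else 0 := by
    simp_rw [← ite_and]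
    rw [Finset.sum_boole, ← Fintype.card_subtype]
    congr 1
    refine Fintype.card_congr (Equiv.subtypeEquivRight fun π => and_congr_right fun _ => ?_)
    simp only [funext_iff, Equiv.eq_symm_apply]
  rw [hcard]
  refine tendsto_finsetSum _ fun π _ => ?_
  split_ifs with hr hσ
  · simpa [hσ] using tendsto_card_forall_comp_eq σ (fun a => π.symm (τ (π a)))
  · simpa [hσ] using tendsto_card_forall_comp_eq σ (fun a => π.symm (τ (π a)))
  · exact tendsto_const_nhds

end Counting

section Trace

variable {R : Type*} [CommSemiring R] {ι : Type*} [Fintype ι] [DecidableEq ι]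

lemma prod_ofFn_apply (n : ℕ) (L : Fin n → Matrix ι ι R) (a b : ι) :
    (List.ofFn L).prod a b = ∑ q : Fin (n + 1) → ι, if q 0 = a ∧ q (Fin.last n) = b then
      ∏ l : Fin n, L l (q l.castSucc) (q l.succ) else 0 := by
  induction n generalizing a with
  | zero =>
    rw [← (Equiv.funUnique (Fin 1) ι).symm.sum_comp]
    simp [Matrix.one_apply, ite_and]
  | succ n ih =>
    rw [List.ofFn_succ, List.prod_cons, Matrix.mul_apply,
      ← (Fin.consEquiv fun _ => ι).sum_comp, Fintype.sum_prod_type]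
    simp only [Fin.consEquiv, Equiv.coe_fn_mk, Fin.cons_zero, Fin.prod_univ_succ,
      ← Fin.succ_last, Fin.cons_succ, Fin.castSucc_zero, ← Fin.succ_castSucc, ite_and,
      Finset.sum_ite_irrel, Finset.sum_const_zero, Finset.sum_ite_eq', Finset.mem_univ, if_true]
    simp_rw [ih, Finset.mul_sum]
    rw [Finset.sum_comm]
    refine Finset.sum_congr rfl fun q _ => ?_
    simp [ite_and]

/-- The trace of a product as a sum over closed paths. -/
lemma trace_prod_ofFn (n : ℕ) (hn : n ≠ 0) (L : Fin n → Matrix ι ι R) :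
    (List.ofFn L).prod.trace = ∑ p : Fin n → ι, ∏ l, L l (p l) (p (finRotate n l)) := by
  obtain ⟨n, rfl⟩ := Nat.exists_eq_succ_of_ne_zero hn
  simp only [Matrix.trace, Matrix.diag_apply, prod_ofFn_apply]
  rw [Finset.sum_comm, ← (Fin.snocEquiv fun _ => ι).sum_comp, Fintype.sum_prod_type,
    Finset.sum_comm]
  refine Finset.sum_congr rfl fun p _ => ?_
  have h0 : ∀ b : ι, (Fin.snoc p b : Fin (n + 1 + 1) → ι) 0 = p 0 := fun b =>
    Fin.snoc_castSucc (α := fun _ => ι) b p 0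
  simp only [Fin.snocEquiv, Equiv.coe_fn_mk, h0, Fin.snoc_last, ite_and, Finset.sum_ite_eq,
    Finset.mem_univ, if_true, Fin.snoc_castSucc]
  rw [Fintype.sum_eq_single (p 0) fun b hb => if_neg hb, if_pos rfl]
  refine Finset.prod_congr rfl fun l _ => ?_
  congr 1
  refine Fin.lastCases ?_ (fun l => ?_) l
  · rw [finRotate_last, Fin.succ_last, Fin.snoc_last]
  · rw [finRotate_of_lt (by simp), Fin.succ_castSucc, Fin.snoc_castSucc]
    rfl

end Trace

section Rotations

lemma val_finRotate {n : ℕ} (l : Fin n) : (finRotate n l : ℕ) = (l + 1) % n := by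
  obtain _ | n := n
  · exact l.elim0
  · rw [finRotate_apply, Fin.val_add, Fin.val_one', Nat.add_mod_mod]

lemma eq_of_comp_finRotate_eq {n : ℕ} {α : Type*} {f : Fin n → α}
    (hf : ∀ l, f (finRotate n l) = f l) (l l' : Fin n) : f l = f l' := by
  obtain _ | n := n
  · exact l.elim0
  · have h : ∀ l : Fin (n + 1), f l = f 0 := by
      intro l
      induction l using Fin.induction with
      | zero => rfl
      | succ i ih => rw [← ih, ← hf i.castSucc, finRotate_of_lt (by simp)]; rfl
    rw [h l, h l']

lemma finRotate_cast_rev_finRotate {n m : ℕ} (h : n = m) (l : Fin n) :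
    finRotate m (Fin.cast h (Fin.rev (finRotate n l))) = Fin.cast h (Fin.rev l) := by
  subst h
  ext
  simp only [val_finRotate, Fin.val_cast, Fin.val_rev]
  rcases (Nat.succ_le_of_lt l.2).eq_or_lt with hl | hl
  · have h0 : (l : ℕ) + 1 = n := hl
    rw [h0, Nat.mod_self, Nat.zero_add, Nat.sub_add_cancel (by omega), Nat.mod_self, Nat.sub_self]
  · have h0 : (l : ℕ) + 1 < n := hl
    rw [Nat.mod_eq_of_lt h0, Nat.mod_eq_of_lt] <;> omega

end Rotations

section Decomposition

variable {I J : Type*} [Fintype I] [Fintype J] [DecidableEq I] [DecidableEq J]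

/-- The simultaneous rotation of all the members of a family of cycles. -/
def rotateAll (n : I → ℕ) (a : Σ i, Fin (n i)) : Σ i, Fin (n i) := ⟨a.1, finRotate _ a.2⟩

/-- A bijection between families of cycles that commutes with the rotations consists of a bijection
between the index sets, and of bijections between corresponding cycles. -/
lemma card_labelledConj_rotateAll (n : I → ℕ) (n' : J → ℕ) (hn : ∀ i, n i ≠ 0)
    (hn' : ∀ j, n' j ≠ 0) (r : (Σ i, Fin (n i)) → ℕ) (s : (Σ j, Fin (n' j)) → ℕ) :
    Fintype.card (LabelledConj (rotateAll n) (rotateAll n') r s) = ∑ ρ : I ≃ J, ∏ i,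
      Fintype.card (LabelledConj (finRotate (n i)) (finRotate (n' (ρ i)))
        (fun l => r ⟨i, l⟩) (fun l => s ⟨ρ i, l⟩)) := by
  simp_rw [← Fintype.card_pi]
  rw [← Fintype.card_sigma]
  symm
  let F : (Σ ρ : I ≃ J, ∀ i, LabelledConj (finRotate (n i)) (finRotate (n' (ρ i)))
      (fun l => r ⟨i, l⟩) (fun l => s ⟨ρ i, l⟩)) → LabelledConj (rotateAll n) (rotateAll n') r s :=
    fun x => ⟨Equiv.sigmaCongr x.1 fun i => (x.2 i).1, by
      ext ⟨i, l⟩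
      exact congrFun (x.2 i).2.1 l, by
      rintro ⟨i, l⟩
      exact Sigma.ext rfl (heq_of_eq ((x.2 i).2.2 l))⟩
  refine Fintype.card_of_bijective (f := F) ⟨?_, ?_⟩
  · rintro ⟨ρ, θ⟩ ⟨ρ', θ'⟩ h
    have h' : ∀ i l, (⟨ρ i, (θ i).1 l⟩ : Σ j, Fin (n' j)) = ⟨ρ' i, (θ' i).1 l⟩ := fun i l =>
      congrFun (congrArg (fun π => (π.1 : (Σ i, Fin (n i)) → Σ j, Fin (n' j))) h) ⟨i, l⟩
    obtain rfl : ρ = ρ' := Equiv.ext fun i =>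
      congrArg Sigma.fst (h' i ⟨0, Nat.pos_of_ne_zero (hn i)⟩)
    refine Sigma.ext rfl (heq_of_eq (funext fun i => Subtype.ext (Equiv.ext fun l => ?_)))
    exact eq_of_heq (Sigma.mk.inj (h' i l)).2
  · rintro ⟨π, hrs, hπ⟩
    have hsymm : ∀ b, π.symm (rotateAll n' b) = rotateAll n (π.symm b) := fun b => by
      rw [Equiv.symm_apply_eq, hπ, Equiv.apply_symm_apply]
    have hfst : ∀ i l l', (π ⟨i, l⟩).1 = (π ⟨i, l'⟩).1 := fun i =>
      eq_of_comp_finRotate_eq (f := fun l => (π ⟨i, l⟩).1) fun l => by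
        have h := congrArg Sigma.fst (hπ ⟨i, l⟩)
        exact h
    have hfst' : ∀ j l l', (π.symm ⟨j, l⟩).1 = (π.symm ⟨j, l'⟩).1 := fun j =>
      eq_of_comp_finRotate_eq (f := fun l => (π.symm ⟨j, l⟩).1) fun l => by
        have h := congrArg Sigma.fst (hsymm ⟨j, l⟩)
        exact h
    let z : ∀ i, Fin (n i) := fun i => ⟨0, Nat.pos_of_ne_zero (hn i)⟩
    let z' : ∀ j, Fin (n' j) := fun j => ⟨0, Nat.pos_of_ne_zero (hn' j)⟩
    let ρ : I ≃ J :=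
      { toFun := fun i => (π ⟨i, z i⟩).1
        invFun := fun j => (π.symm ⟨j, z' j⟩).1
        left_inv := fun i => by
          change (π.symm ⟨(π ⟨i, z i⟩).1, _⟩).1 = i
          rw [hfst' _ _ (π ⟨i, z i⟩).2, Sigma.eta, Equiv.symm_apply_apply]
        right_inv := fun j => by
          change (π ⟨(π.symm ⟨j, z' j⟩).1, _⟩).1 = j
          rw [hfst _ _ (π.symm ⟨j, z' j⟩).2, Sigma.eta, Equiv.apply_symm_apply] }
    have hex : ∀ i l, ∃ l', π ⟨i, l⟩ = ⟨ρ i, l'⟩ := by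
      intro i l
      have h : (π ⟨i, l⟩).1 = ρ i := hfst i l (z i)
      generalize π ⟨i, l⟩ = b at h ⊢
      obtain ⟨j, l'⟩ := b
      obtain rfl : j = ρ i := h
      exact ⟨l', rfl⟩
    choose θ hθ using hex
    have hbij : ∀ i, Function.Bijective (θ i) := by
      intro i
      constructor
      · intro l l' hl
        have : π ⟨i, l⟩ = π ⟨i, l'⟩ := by rw [hθ, hθ, hl]
        exact eq_of_heq (Sigma.mk.inj (π.injective this)).2
      · intro l'
        obtain ⟨⟨i', l⟩, hl⟩ := π.surjective ⟨ρ i, l'⟩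
        rw [hθ] at hl
        obtain rfl : i' = i := ρ.injective (Sigma.mk.inj hl).1
        exact ⟨l, eq_of_heq (Sigma.mk.inj hl).2⟩
    refine ⟨⟨ρ, fun i => ⟨Equiv.ofBijective (θ i) (hbij i), ?_, fun l => ?_⟩⟩, ?_⟩
    · ext l
      have := congrFun hrs ⟨i, l⟩
      rwa [Function.comp_apply, hθ] at this
    · have : π ⟨i, finRotate _ l⟩ = rotateAll n' (π ⟨i, l⟩) := hπ ⟨i, l⟩
      rw [hθ, hθ] at this
      exact eq_of_heq (Sigma.mk.inj this).2
    · refine Subtype.ext (Equiv.ext ?_)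
      rintro ⟨i, l⟩
      exact (hθ i l).symm

end Decomposition

section Words

/-- The indices of the letters of a word. -/
def letterIndex (w : StarWord) (l : Fin w.length) : ℕ := (w.get l).index

lemma StarLetter.ext_of_isStarFree {u v : StarWord} (hu : IsStarFree u) (hv : IsStarFree v)
    {l : Fin u.length} {l' : Fin v.length} (h : letterIndex u l = letterIndex v l') :
    u.get l = v.get l' := by
  have h1 := hu _ (List.get_mem u l)
  have h2 := hv _ (List.get_mem v l')
  unfold letterIndex at h
  generalize u.get l = a at *
  generalize v.get l' = b at *
  obtain ⟨i, s⟩ := a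
  obtain ⟨j, t⟩ := b
  simp_all

/-- Words that are matched by a bijection commuting with the rotations are equal up to a cyclic
permutation. -/
lemma isRotated_of_labelledConj {u v : StarWord} (hu : IsStarFree u) (hv : IsStarFree v)
    (θ : LabelledConj (finRotate u.length) (finRotate v.length) (letterIndex u) (letterIndex v)) :
    u ~r v := by
  obtain ⟨θ, hθ, hrot⟩ := θ
  have hlen : u.length = v.length := by simpa using Fintype.card_congr θ
  rcases Nat.eq_zero_or_pos u.length with h0 | h0
  · have hu0 : u = [] := List.length_eq_zero_iff.1 h0
    have hv0 : v = [] := List.length_eq_zero_iff.1 (by omega)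
    rw [hu0, hv0]
  have hval : ∀ (k : ℕ) (hk : k < u.length),
      (θ ⟨k, hk⟩ : ℕ) = (k + θ ⟨0, h0⟩) % v.length := by
    intro k
    induction k with
    | zero => intro _; rw [zero_add, Nat.mod_eq_of_lt (θ _).2]
    | succ k ih =>
      intro hk
      have : (⟨k + 1, hk⟩ : Fin u.length) = finRotate _ ⟨k, by omega⟩ := by
        ext; rw [val_finRotate, Nat.mod_eq_of_lt hk]
      rw [this, hrot, val_finRotate, ih, Nat.mod_add_mod]
      congr 1
      omega
  refine List.IsRotated.symm ⟨θ ⟨0, h0⟩, List.ext_getElem (by simp [hlen]) fun k hk hk' => ?_⟩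
  rw [List.getElem_rotate]
  have h := StarLetter.ext_of_isStarFree hv hu (congrFun hθ ⟨k, hk'⟩)
  exact (getElem_congr_idx (hval k hk').symm).trans h

end Words

section Orbits

variable {E : Type*} [Fintype E] {κ : E → E}

lemma two_mul_card_quot_eq_iff (hκ : ∀ e, κ e ≠ e) :
    2 * Nat.card (Quot fun a b : E => b = κ a) = Fintype.card E ↔ ∀ e, κ (κ e) = e := by
  classical
  set mk : E → Quot fun a b : E => b = κ a := Quot.mk _
  have hmk : ∀ e, mk (κ e) = mk e := fun e => (Quot.sound (r := fun a b : E => b = κ a) rfl).symm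
  have : Finite (Quot fun a b : E => b = κ a) := Finite.of_surjective mk Quot.mk_surjective
  have : Fintype (Quot fun a b : E => b = κ a) := Fintype.ofFinite _
  have hsub : ∀ e, ({e, κ e} : Finset E) ⊆ Finset.univ.filter fun a => mk a = mk e := by
    intro e a ha
    rcases Finset.mem_insert.1 ha with rfl | ha
    · simp
    · rw [Finset.mem_singleton.1 ha]; simp [hmk]
  have htwo : ∀ e, ({e, κ e} : Finset E).card = 2 := fun e => Finset.card_pair (hκ e).symm
  have hle : ∀ c ∈ Finset.univ, 2 ≤ (Finset.univ.filter fun a => mk a = c).card := by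
    intro c _
    obtain ⟨e, rfl⟩ := Quot.mk_surjective c
    exact (htwo e).symm.le.trans (Finset.card_le_card (hsub e))
  have hcard : Fintype.card E = ∑ c, (Finset.univ.filter fun a => mk a = c).card := by
    rw [← Finset.card_univ]
    exact Finset.card_eq_sum_card_fiberwise fun _ _ => Finset.mem_coe.2 (Finset.mem_univ _)
  have hconst : 2 * Nat.card (Quot fun a b : E => b = κ a) =
      ∑ _c : Quot fun a b : E => b = κ a, 2 := by
    simp [mul_comm]
  rw [hcard, hconst, Finset.sum_eq_sum_iff_of_le hle]
  constructor
  · intro h e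
    have heq := Finset.eq_of_subset_of_card_le (hsub e) (by rw [htwo, ← h _ (Finset.mem_univ _)])
    have hmem : κ (κ e) ∈ ({e, κ e} : Finset E) := by rw [heq]; simp [hmk]
    simpa [hκ (κ e)] using hmem
  · intro h c _
    obtain ⟨e, rfl⟩ := Quot.mk_surjective c
    have hlift : ∀ a, mk a = mk e → ({a, κ a} : Finset E) = {e, κ e} := by
      intro a ha
      exact congrArg (Quot.lift (fun a => ({a, κ a} : Finset E)) (by
        rintro a _ rfl
        rw [h, Finset.pair_comm])) ha
    rw [← htwo e]
    refine congrArg _ ((hsub e).antisymm fun a ha => ?_)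
    rw [← hlift a (Finset.mem_filter.1 ha).2]
    exact Finset.mem_insert_self _ _

end Orbits

section SphereCount

variable {w : StarWord}

lemma length_starWord (w : StarWord) : (starWord w).length = w.length := by
  simp [starWord]

/-- The edge of the first face that carries the `l`-th letter of `w`. -/
def edgeFst (w : StarWord) (l : Fin w.length) : Edge ![w, starWord w] := ⟨0, l⟩

/-- The edge of the second face that carries the conjugate of the `l`-th letter of `w`. -/
def edgeSnd (w : StarWord) (l : Fin w.length) : Edge ![w, starWord w] :=
  ⟨1, Fin.cast (length_starWord w).symm (Fin.rev l)⟩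

lemma edgeFst_injective : Function.Injective (edgeFst w) := fun _ _ h =>
  eq_of_heq (Sigma.mk.inj h).2

lemma edgeSnd_injective : Function.Injective (edgeSnd w) := fun _ _ h =>
  Fin.rev_injective (Fin.cast_injective _ (eq_of_heq (Sigma.mk.inj h).2))

lemma edge_eq_edgeFst_or_edgeSnd (e : Edge ![w, starWord w]) :
    (∃ l, e = edgeFst w l) ∨ ∃ l, e = edgeSnd w l := by
  obtain ⟨j, l⟩ := e
  induction j using Fin.cases with
  | zero => exact Or.inl ⟨l, rfl⟩
  | succ j =>
    obtain rfl : j = 0 := Subsingleton.elim _ _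
    refine Or.inr ⟨Fin.rev (Fin.cast (length_starWord w) l), ?_⟩
    unfold edgeSnd
    rw [Fin.rev_rev]
    rfl

lemma edgeFst_ne_edgeSnd (l l' : Fin w.length) : edgeFst w l ≠ edgeSnd w l' := fun h =>
  absurd (congrArg Sigma.fst h) (Fin.zero_ne_one (n := 0))

lemma next_edgeFst (l : Fin w.length) : (edgeFst w l).next = edgeFst w (finRotate _ l) := rfl

lemma next_edgeSnd (l : Fin w.length) :
    (edgeSnd w (finRotate _ l)).next = edgeSnd w l :=
  Sigma.ext rfl (heq_of_eq (finRotate_cast_rev_finRotate (length_starWord w).symm l))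

lemma letter_edgeFst (l : Fin w.length) : (edgeFst w l).letter = w.get l := rfl

lemma letter_edgeSnd (l : Fin w.length) : (edgeSnd w l).letter = (w.get l).conj := by
  change (starWord w).get (Fin.cast (length_starWord w).symm (Fin.rev l)) = _
  simp only [starWord, List.get_eq_getElem, List.getElem_map, List.getElem_reverse]
  congr 2
  have := l.2
  have h : (Fin.cast (length_starWord w).symm (Fin.rev l) : ℕ) = w.length - (l + 1) := rfl
  change w.length - 1 - (Fin.cast (length_starWord w).symm (Fin.rev l) : ℕ) = l
  omega

/-- The edges of the two faces. -/
noncomputable def edgeEquiv (w : StarWord) :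
    Fin w.length ⊕ Fin w.length ≃ Edge ![w, starWord w] :=
  Equiv.ofBijective (Sum.elim (edgeFst w) (edgeSnd w))
    ⟨edgeFst_injective.sumElim edgeSnd_injective edgeFst_ne_edgeSnd, fun e => by
      rcases edge_eq_edgeFst_or_edgeSnd e with ⟨l, rfl⟩ | ⟨l, rfl⟩
      exacts [⟨Sum.inl l, rfl⟩, ⟨Sum.inr l, rfl⟩]⟩

lemma card_edge : Fintype.card (Edge ![w, starWord w]) = 2 * w.length := by
  rw [← Fintype.card_congr (edgeEquiv w), Fintype.card_sum, Fintype.card_fin, two_mul]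

variable {φ : Equiv.Perm (Edge ![w, starWord w])}

lemma fst_apply_ne (hfree : IsStarFree w) (hφ : IsAdmissible φ) (e : Edge ![w, starWord w]) :
    (φ e).1 ≠ e.1 := by
  intro h
  have hl := congrArg StarLetter.starred (hφ.letter_eq e)
  rcases edge_eq_edgeFst_or_edgeSnd e with ⟨l, rfl⟩ | ⟨l, rfl⟩ <;>
  rcases edge_eq_edgeFst_or_edgeSnd (φ _) with ⟨l', hl'⟩ | ⟨l', hl'⟩ <;>
  rw [hl'] at h hl
  · rw [letter_edgeFst, letter_edgeFst] at hl
    simp [StarLetter.conj, hfree _ (List.get_mem w l), hfree _ (List.get_mem w l'),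
      -List.get_eq_getElem] at hl
  · exact Fin.zero_ne_one (n := 0) h.symm
  · exact Fin.zero_ne_one (n := 0) h
  · rw [letter_edgeSnd, letter_edgeSnd] at hl
    simp [StarLetter.conj, hfree _ (List.get_mem w l), hfree _ (List.get_mem w l'),
      -List.get_eq_getElem] at hl

lemma isSpherical_iff (hne : w ≠ []) (hfree : IsStarFree w) (hφ : IsAdmissible φ) :
    IsSpherical φ ↔ ∀ e, (φ (φ e).next).next = e := by
  have hcomp : Nat.card (Component φ) = 1 := by
    rw [Nat.card_eq_one_iff_unique]
    have h0 : 0 < w.length := List.length_pos_iff.2 hne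
    let mk : Fin 2 → Component φ := Quot.mk _
    have hmk : ∀ j : Fin 2, mk j = mk 0 := by
      intro j
      induction j using Fin.cases with
      | zero => rfl
      | succ j =>
        obtain rfl : j = 0 := Subsingleton.elim _ _
        refine (Quot.sound ⟨edgeFst w ⟨0, h0⟩, rfl, ?_⟩).symm
        have := fst_apply_ne hfree hφ (edgeFst w ⟨0, h0⟩)
        exact Fin.eq_one_of_ne_zero _ this
    refine ⟨⟨fun a b => ?_⟩, ⟨mk 0⟩⟩
    obtain ⟨i, rfl⟩ := Quot.mk_surjective a
    obtain ⟨j, rfl⟩ := Quot.mk_surjective b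
    exact (hmk i).trans (hmk j).symm
  have hglued : 2 * Nat.card (GluedEdge φ) = 2 * w.length := by
    rw [← card_edge]
    exact (two_mul_card_quot_eq_iff hφ.ne_self).2 hφ.involutive
  have hvertex : 2 * Nat.card (Vertex φ) = 2 * w.length ↔ ∀ e, (φ (φ e).next).next = e := by
    rw [← card_edge]
    exact two_mul_card_quot_eq_iff (κ := fun e => (φ e).next) fun e he => by
      have h := congrArg Sigma.fst he
      exact fst_apply_ne hfree hφ e h
  rw [← hvertex, IsSpherical, eulerChar, and_iff_right hcomp]
  omega

/-- The pairing of the edges of the two faces defined by a permutation of the letters. -/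
noncomputable def pairing (w : StarWord) (θ : Equiv.Perm (Fin w.length)) :
    Equiv.Perm (Edge ![w, starWord w]) :=
  (edgeEquiv w).symm.trans
    (((Equiv.sumCongr θ θ.symm).trans (Equiv.sumComm _ _)).trans (edgeEquiv w))

lemma pairing_edgeFst (θ : Equiv.Perm (Fin w.length)) (l : Fin w.length) :
    pairing w θ (edgeFst w l) = edgeSnd w (θ l) := by
  have : edgeFst w l = edgeEquiv w (Sum.inl l) := rfl
  rw [this, pairing, Equiv.trans_apply, Equiv.symm_apply_apply]
  rfl

lemma pairing_edgeSnd (θ : Equiv.Perm (Fin w.length)) (l : Fin w.length) :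
    pairing w θ (edgeSnd w l) = edgeFst w (θ.symm l) := by
  have : edgeSnd w l = edgeEquiv w (Sum.inr l) := rfl
  rw [this, pairing, Equiv.trans_apply, Equiv.symm_apply_apply]
  rfl

lemma starLetter_conj_conj (a : StarLetter) : a.conj.conj = a := by
  simp [StarLetter.conj]

lemma starLetter_conj_injective : Function.Injective StarLetter.conj :=
  Function.LeftInverse.injective starLetter_conj_conj

lemma isAdmissible_pairing {θ : Equiv.Perm (Fin w.length)} (hθ : ∀ l, w.get (θ l) = w.get l) :
    IsAdmissible (pairing w θ) where
  involutive e := by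
    rcases edge_eq_edgeFst_or_edgeSnd e with ⟨l, rfl⟩ | ⟨l, rfl⟩
    · rw [pairing_edgeFst, pairing_edgeSnd, Equiv.symm_apply_apply]
    · rw [pairing_edgeSnd, pairing_edgeFst, Equiv.apply_symm_apply]
  ne_self e := by
    rcases edge_eq_edgeFst_or_edgeSnd e with ⟨l, rfl⟩ | ⟨l, rfl⟩
    · rw [pairing_edgeFst]; exact (edgeFst_ne_edgeSnd _ _).symm
    · rw [pairing_edgeSnd]; exact edgeFst_ne_edgeSnd _ _
  letter_eq e := by
    rcases edge_eq_edgeFst_or_edgeSnd e with ⟨l, rfl⟩ | ⟨l, rfl⟩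
    · rw [pairing_edgeFst, letter_edgeFst, letter_edgeSnd, hθ]
    · rw [pairing_edgeSnd, letter_edgeFst, letter_edgeSnd, starLetter_conj_conj, ← hθ,
        Equiv.apply_symm_apply]

lemma exists_eq_pairing (hfree : IsStarFree w) (hφ : IsAdmissible φ) :
    ∃ θ, φ = pairing w θ ∧ ∀ l, w.get (θ l) = w.get l := by
  have hex : ∀ l, ∃ l', φ (edgeFst w l) = edgeSnd w l' := by
    intro l
    rcases edge_eq_edgeFst_or_edgeSnd (φ (edgeFst w l)) with ⟨l', hl'⟩ | h
    · exact absurd (congrArg Sigma.fst hl') (fst_apply_ne hfree hφ (edgeFst w l))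
    · exact h
  choose θ hθ using hex
  have hinj : Function.Injective θ := fun l l' h =>
    edgeFst_injective (φ.injective (by rw [hθ, hθ, h]))
  have hbij := Finite.injective_iff_bijective.1 hinj
  refine ⟨Equiv.ofBijective θ hbij, Equiv.ext fun e => ?_, fun l => ?_⟩
  · rcases edge_eq_edgeFst_or_edgeSnd e with ⟨l, rfl⟩ | ⟨l, rfl⟩
    · rw [pairing_edgeFst, hθ]; rfl
    · obtain ⟨l, rfl⟩ := hbij.2 l
      have h : (Equiv.ofBijective θ hbij).symm (θ l) = l :=
        (Equiv.ofBijective θ hbij).symm_apply_apply l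
      rw [pairing_edgeSnd, h, ← hθ, hφ.involutive]
  · have h := hφ.letter_eq (edgeFst w l)
    rw [hθ, letter_edgeFst, letter_edgeSnd] at h
    exact starLetter_conj_injective h

lemma next_pairing_next_pairing_iff (θ : Equiv.Perm (Fin w.length)) :
    (∀ e, (pairing w θ (pairing w θ e).next).next = e) ↔
      ∀ l, θ (finRotate _ l) = finRotate _ (θ l) := by
  have hsnd : ∀ l, (edgeSnd w l).next = edgeSnd w ((finRotate _).symm l) := fun l => by
    rw [← next_edgeSnd ((finRotate _).symm l), Equiv.apply_symm_apply]
  have h1 : (∀ l, θ (finRotate _ l) = finRotate _ (θ l)) ↔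
      ∀ l, (finRotate _).symm (θ (finRotate _ l)) = θ l := by
    simp_rw [Equiv.symm_apply_eq]
  rw [h1]
  constructor
  · intro h l
    have := h (edgeSnd w (θ l))
    rw [pairing_edgeSnd, next_edgeFst, pairing_edgeFst, hsnd, Equiv.symm_apply_apply] at this
    exact edgeSnd_injective this
  · intro h e
    rcases edge_eq_edgeFst_or_edgeSnd e with ⟨l, rfl⟩ | ⟨l, rfl⟩
    · obtain ⟨l, rfl⟩ := (finRotate _).surjective l
      rw [pairing_edgeFst, hsnd, h, pairing_edgeSnd, Equiv.symm_apply_apply, next_edgeFst]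
    · obtain ⟨l, rfl⟩ := θ.surjective l
      rw [pairing_edgeSnd, next_edgeFst, pairing_edgeFst, hsnd, Equiv.symm_apply_apply, h]

/-- Spherical pairings are the automorphisms of the cyclic word `w`. -/
theorem card_labelledConj_eq_sphereCount (hne : w ≠ []) (hfree : IsStarFree w) :
    Fintype.card (LabelledConj (finRotate w.length) (finRotate w.length)
      (letterIndex w) (letterIndex w)) = sphereCount w := by
  have hget : ∀ θ : Equiv.Perm (Fin w.length), letterIndex w ∘ θ = letterIndex w ↔
      ∀ l, w.get (θ l) = w.get l := fun θ =>
    ⟨fun h l => StarLetter.ext_of_isStarFree hfree hfree (congrFun h l),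
      fun h => funext fun l => congrArg StarLetter.index (h l)⟩
  rw [← Nat.card_eq_fintype_card]
  refine Nat.card_congr (Equiv.ofBijective (fun θ => ⟨pairing w θ.1, ?_⟩) ⟨fun θ θ' h => ?_, ?_⟩)
  · have hadm := isAdmissible_pairing ((hget _).1 θ.2.1)
    exact ⟨hadm, (isSpherical_iff hne hfree hadm).2 ((next_pairing_next_pairing_iff _).2 θ.2.2)⟩
  · refine Subtype.ext (Equiv.ext fun l => edgeSnd_injective ?_)
    rw [← pairing_edgeFst, ← pairing_edgeFst, Subtype.mk.inj h]
  · rintro ⟨φ, hadm, hsph⟩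
    obtain ⟨θ, rfl, hθ⟩ := exists_eq_pairing hfree hadm
    exact ⟨⟨θ, (hget θ).2 hθ, (next_pairing_next_pairing_iff θ).1
      ((isSpherical_iff hne hfree hadm).1 hsph)⟩, rfl⟩

end SphereCount

section Traces

lemma trace_wordMatrix {N : ℕ} (M : ℕ → Matrix (Fin N) (Fin N) ℂ) {w : StarWord} (hne : w ≠ [])
    (hfree : IsStarFree w) :
    (wordMatrix M w).trace = ∑ p : Fin w.length → Fin N,
      ∏ l, M (letterIndex w l) (p l) (p (finRotate _ l)) := by
  have h : (w.map fun a => if a.starred then (M a.index)ᴴ else M a.index) =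
      List.ofFn fun l => M (letterIndex w l) := by
    refine List.ext_getElem (by simp) fun k hk hk' => ?_
    have hkw : k < w.length := by simpa using hk
    have hs := hfree w[k] (List.getElem_mem hkw)
    simp [letterIndex, hs]
  rw [wordMatrix, h, trace_prod_ofFn _ (List.length_pos_iff.2 hne).ne']

lemma prod_trace_wordMatrix {N : ℕ} {I : Type*} [Fintype I] [DecidableEq I]
    (M : ℕ → Matrix (Fin N) (Fin N) ℂ) {u : I → StarWord} (hne : ∀ i, u i ≠ [])
    (hfree : ∀ i, IsStarFree (u i)) :
    ∏ i, (wordMatrix M (u i)).trace = ∑ p : (Σ i, Fin (u i).length) → Fin N,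
      ∏ a : Σ i, Fin (u i).length,
        M (letterIndex (u a.1) a.2) (p a) (p (rotateAll (fun i => (u i).length) a)) := by
  simp_rw [fun i => trace_wordMatrix M (hne i) (hfree i)]
  rw [Finset.prod_univ_sum, Fintype.piFinset_univ, ← (Equiv.piCurry fun _ _ => Fin N).sum_comp]
  refine Finset.sum_congr rfl fun p _ => ?_
  rw [Fintype.prod_sigma]
  rfl

lemma hasFiniteMoments_trace_wordMatrix {Ω : Type*} [MeasurableSpace Ω] {μ : Measure Ω}
    [IsProbabilityMeasure μ] {N : ℕ} {G : ℕ → Ω → Matrix (Fin N) (Fin N) ℂ}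
    (hG : IsGinibreFamily N G μ) {w : StarWord} (hne : w ≠ []) (hfree : IsStarFree w) :
    HasFiniteMoments (fun ω => (wordMatrix (fun r => G r ω) w).trace) μ := by
  simp_rw [fun ω => trace_wordMatrix (fun r => G r ω) hne hfree]
  exact HasFiniteMoments.sum _ fun p _ => HasFiniteMoments.prod _ fun l _ =>
    HasFiniteMoments.of_hasLaw (hG.hasLaw _ _ _)

end Traces

theorem mainTheorem6
    {m : ℕ} (w : Fin m → StarWord)
    (hne : ∀ i, w i ≠ [])
    (hfree : ∀ i, IsStarFree (w i))
    (hdistinct : ∀ i j, i ≠ j → TraceDistinct (w i) (w j))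
    {Ω : ℕ → Type*} [∀ N, MeasurableSpace (Ω N)]
    (μ : ∀ N, Measure (Ω N)) [∀ N, IsProbabilityMeasure (μ N)]
    (G : ∀ N, ℕ → Ω N → Matrix (Fin N) (Fin N) ℂ)
    (hG : ∀ N, IsGinibreFamily N (G N) (μ N)) :
    TendstoInDistribution
      (fun (N : ℕ) (ω : Ω N) (i : Fin m) =>
        (wordMatrix (fun r => G N r ω) (w i)).trace)
      atTop
      (fun (z : Fin m → ℂ) => z)
      μ
      (Measure.pi fun i => complexGaussian (sphereCount (w i) : ℝ≥0)) := by
  refine tendstoInDistribution_of_tendsto_moments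
    (fun N i => hasFiniteMoments_trace_wordMatrix (hG N) (hne i) (hfree i)) ?_
  intro I J _ _ x y
  classical
  have hlim : ∫ z, (∏ i, z (x i)) * ∏ j, starRingEnd ℂ (z (y j))
      ∂Measure.pi (fun i => complexGaussian (sphereCount (w i) : ℝ≥0)) =
      (Fintype.card (LabelledConj (rotateAll fun i => (w (x i)).length)
        (rotateAll fun j => (w (y j)).length) (fun a => letterIndex (w (x a.1)) a.2)
        (fun b => letterIndex (w (y b.1)) b.2)) : ℂ) := by
    rw [integral_prod_mul_prod_conj (X := fun i (z : Fin m → ℂ) => z i)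
      (s := fun i => (sphereCount (w i) : ℝ≥0))
      (fun i => ⟨(measurable_pi_apply i).aemeasurable, (measurePreserving_eval _ i).map_eq⟩)
      (iIndepFun_pi (X := fun _ z => z) fun i => by fun_prop),
      card_labelledConj_rotateAll _ _ (fun i => (List.length_pos_iff.2 (hne _)).ne')
        (fun j => (List.length_pos_iff.2 (hne _)).ne')]
    push_cast
    refine Finset.sum_congr rfl fun ρ _ => Finset.prod_congr rfl fun i _ => ?_
    change _ = (Fintype.card (LabelledConj (finRotate (w (x i)).length)
      (finRotate (w (y (ρ i))).length) (letterIndex (w (x i))) (letterIndex (w (y (ρ i))))) : ℂ)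
    split_ifs with h
    · rw [← h, card_labelledConj_eq_sphereCount (hne _) (hfree _)]
    · have : IsEmpty (LabelledConj (finRotate (w (x i)).length) (finRotate (w (y (ρ i))).length)
          (letterIndex (w (x i))) (letterIndex (w (y (ρ i))))) :=
        ⟨fun θ => hdistinct _ _ h (isRotated_of_labelledConj (hfree _) (hfree _) θ)⟩
      rw [Fintype.card_eq_zero, Nat.cast_zero]
  rw [hlim]
  refine (tendsto_integral_sum_mul_conj_sum hG (rotateAll fun i => (w (x i)).length)
    (rotateAll fun j => (w (y j)).length) (fun a => letterIndex (w (x a.1)) a.2)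
    (fun b => letterIndex (w (y b.1)) b.2)).congr fun N => ?_
  congr 1
  ext ω
  rw [← map_prod, prod_trace_wordMatrix (fun r => G N r ω) (fun i => hne (x i))
    (fun i => hfree (x i)), prod_trace_wordMatrix (fun r => G N r ω) (fun j => hne (y j))
    (fun j => hfree (y j))]
  simp only [map_sum, map_prod]
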